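/- There is an absolute constant $C>0$ such that the following holds for every $n\ge 0$, every $\epsilon\in(0,1]$ and every submodular function $f:\{0,1\}^n\to[0,1]$, that is, every $f$ with $f(x\vee y)+f(x\wedge y)\le f(x)+f(y)$ for all $x,y\in\{0,1\}^n$, where $\vee$ and $\wedge$ are the coordinatewise maximum and minimum. There is a real polynomial $p$ in $n$ variables of total degree at most $C\,\epsilon^{-4/5}\log(1/\epsilon)$ such that $\|f-p\|_2\le\epsilon$, where $\|g\|_2=\bigl(2^{-n}\sum_{x\in\{0,1\}^n}g(x)^2\bigr)^{1/2}$ is the $\ell_2$ norm with respect to the uniform distribution on $\{0,1\}^n$. -/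

import Mathlib

/-- A point of the Boolean cube `{0,1}^n`, with `true` for `1` and `false` for `0`.
The union and the intersection of subsets of `[n]` are the coordinatewise `⊔` and `⊓`. -/
abbrev Cube (n : ℕ) : Type := Fin n → Bool

/-- A real function on `{0,1}^n` (equivalently, a set function on `[n]`) is submodular if
`f (A ∪ B) + f (A ∩ B) ≤ f A + f B` for all `A, B`. -/
def CubeSubmodular {n : ℕ} (f : Cube n → ℝ) : Prop :=
  ∀ x y : Cube n, f (x ⊔ y) + f (x ⊓ y) ≤ f x + f y

/-- The `ℓ₂` norm with respect to the uniform distribution on `{0,1}^n`: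
`‖f‖₂ = (E_x [f(x)^2])^{1/2}`. -/
noncomputable def cubeL2Norm {n : ℕ} (f : Cube n → ℝ) : ℝ :=
  Real.sqrt ((∑ x : Cube n, f x ^ 2) / 2 ^ n)

/-- The function on `{0,1}^n` given by a real polynomial in `n` variables. -/
noncomputable def polyOnCube {n : ℕ} (p : MvPolynomial (Fin n) ℝ) (x : Cube n) : ℝ :=
  MvPolynomial.eval (fun i => if x i then (1 : ℝ) else 0) p

/-! Write D_i for the discrete derivative in direction i. Submodularity makes each D_i antitone.
Telescoping along the true coordinates of x then bounds the sum of x_i max(D_i(x), 0) by 1, and the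
dual x ↦ f(¬x) handles the negative parts.

For a set J of coordinates, the Walsh weight of f on the sets with more than d elements outside J is
controlled by the mean squares of the mixed second derivatives outside J. If these total A,
truncation gives degree |J| + d and squared error A/(16d²) (`exists_poly_of_sum_cubeHess_sq_le`). It
remains to find J of size O(k/a) with A = O(√a).

To choose J, note that the event D_i > a is decreasing. If it has probability at most 1/2 at a bias
of order 1/k, joining k independent copies makes it exponentially rare at bias 1/4; by Markov only
O(k/a) coordinates fail (`CubeSubmodular.exists_small_set`).

To bound A, sum by parts over pairs (x, y), testing Ψ = Σ D_i|D_i|^(1/2) against the divergence Σ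
(D_j(x ⊓ y) - D_j(x ⊔ y))^(1/2) (x_j - y_j). The exponents 3/2 and 1/2 combine to squared second
derivatives; the divergence has bounded norm, Ψ has norm O(√a), and Cauchy-Schwarz finishes
(`sum_cubeHess_sq_le`).

With a = ε^(4/5), d of order 1/a and k of order log(1/ε), the squared error is of order √a · a² =
ε². -/

open Finset

section

variable {n : ℕ}

/-! ### Sums over the Boolean cube -/

/-- Expectation-like sum on the cube for the product of the one-coordinate weight `w`. -/
noncomputable def cubeExp (w : Bool → ℝ) (g : Cube n → ℝ) : ℝ :=
  ∑ x, (∏ i, w (x i)) * g x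

/-- The Bernoulli weight giving mass `l` to `true`. -/
def biasWeight (l : ℝ) (b : Bool) : ℝ := if b then l else 1 - l

/-- Negation of one coordinate. -/
def flipCoord (i : Fin n) (x : Cube n) : Cube n := Function.update x i (!x i)

lemma flipCoord_same (i : Fin n) (x : Cube n) : flipCoord i x i = !x i := by
  simp [flipCoord]

lemma flipCoord_of_ne {i j : Fin n} (h : j ≠ i) (x : Cube n) : flipCoord i x j = x j := by
  simp [flipCoord, h]

lemma flipCoord_involutive (i : Fin n) : Function.Involutive (flipCoord (n := n) i) := by
  intro x
  funext j
  by_cases h : j = i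
  · subst h; simp [flipCoord_same]
  · simp [flipCoord_of_ne h]

lemma sum_flipCoord (i : Fin n) (g : Cube n → ℝ) : ∑ x, g (flipCoord i x) = ∑ x, g x :=
  Equiv.sum_comp (flipCoord_involutive i).toPerm g

/-- Average the sum with its image under the flip of coordinate i. This is independence of x_i from
functions that ignore it. -/
lemma sum_coord_mul (i : Fin n) (c : Bool → ℝ) (R : Cube n → ℝ)
    (hR : ∀ x, R (flipCoord i x) = R x) :
    ∑ x, c (x i) * R x = (c true + c false) / 2 * ∑ x, R x := by
  have h1 := sum_flipCoord i (fun x => c (x i) * R x)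
  have h2 : 2 * ∑ x, c (x i) * R x = ∑ x, (c true + c false) * R x := by
    rw [two_mul]
    nth_rewrite 1 [← h1]
    rw [← sum_add_distrib]
    refine sum_congr rfl fun x _ => ?_
    rw [hR, flipCoord_same]
    cases x i <;> simp <;> ring
  rw [← mul_sum] at h2
  linarith

lemma biasWeight_nonneg {l : ℝ} (h0 : 0 ≤ l) (h1 : l ≤ 1) (b : Bool) : 0 ≤ biasWeight l b := by
  unfold biasWeight; split_ifs <;> linarith

lemma cubeExp_mono {w : Bool → ℝ} (hw : ∀ b, 0 ≤ w b) {g h : Cube n → ℝ} (hgh : ∀ x, g x ≤ h x) :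
    cubeExp w g ≤ cubeExp w h :=
  sum_le_sum fun x _ => mul_le_mul_of_nonneg_left (hgh x) (prod_nonneg fun _ _ => hw _)

lemma cubeExp_nonneg {w : Bool → ℝ} (hw : ∀ b, 0 ≤ w b) {g : Cube n → ℝ} (hg : ∀ x, 0 ≤ g x) :
    0 ≤ cubeExp w g :=
  sum_nonneg fun x _ => mul_nonneg (prod_nonneg fun _ _ => hw _) (hg x)

lemma cubeExp_sum {ι : Type*} (s : Finset ι) (w : Bool → ℝ) (g : ι → Cube n → ℝ) :
    cubeExp w (fun x => ∑ i ∈ s, g i x) = ∑ i ∈ s, cubeExp w (g i) := by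
  unfold cubeExp
  rw [sum_comm]
  simp_rw [mul_sum]

lemma cubeExp_const_mul (w : Bool → ℝ) (c : ℝ) (g : Cube n → ℝ) :
    cubeExp w (fun x => c * g x) = c * cubeExp w g := by
  unfold cubeExp
  rw [mul_sum]
  exact sum_congr rfl fun x _ => by ring

lemma cubeExp_mul_const (w : Bool → ℝ) (c : ℝ) (g : Cube n → ℝ) :
    cubeExp w (fun x => g x * c) = cubeExp w g * c := by
  unfold cubeExp
  rw [sum_mul]
  exact sum_congr rfl fun x _ => by ring

lemma sum_prod_coord (c : Fin n → Bool → ℝ) :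
    ∑ x : Cube n, ∏ i, c i (x i) = ∏ i, (c i true + c i false) := by
  have := (Finset.prod_univ_sum (fun _ : Fin n => (univ : Finset Bool)) c).symm
  rw [Fintype.piFinset_univ] at this
  simpa using this

lemma cubeExp_one (l : ℝ) : cubeExp (n := n) (biasWeight l) (fun _ => 1) = 1 := by
  simp only [cubeExp, mul_one]
  rw [sum_prod_coord (fun _ => biasWeight l)]
  simp [biasWeight]

lemma cubeExp_coord {l : ℝ} (i : Fin n) (g : Cube n → ℝ) (hg : ∀ x, g (flipCoord i x) = g x) :
    cubeExp (biasWeight l) (fun x => (if x i then 1 else 0) * g x)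
      = l * cubeExp (biasWeight l) g := by
  have hR : ∀ x : Cube n, (∏ j ∈ univ.erase i, biasWeight l (flipCoord i x j)) * g (flipCoord i x)
      = (∏ j ∈ univ.erase i, biasWeight l (x j)) * g x := by
    intro x
    rw [hg]
    congr 1
    exact prod_congr rfl fun j hj => by rw [flipCoord_of_ne (ne_of_mem_erase hj)]
  have key : ∀ c : Bool → ℝ, cubeExp (biasWeight l) (fun x => c (x i) * g x)
      = (l * c true + (1 - l) * c false) / 2
        * ∑ x : Cube n, (∏ j ∈ univ.erase i, biasWeight l (x j)) * g x := by
    intro c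
    have := sum_coord_mul i (fun b => biasWeight l b * c b)
      (fun x => (∏ j ∈ univ.erase i, biasWeight l (x j)) * g x) hR
    refine Eq.trans ?_ (this.trans (by simp [biasWeight]))
    refine sum_congr rfl fun x _ => ?_
    rw [← mul_prod_erase univ _ (mem_univ i)]
    ring
  have h1 := key (fun b => if b then 1 else 0)
  have h2 := key (fun _ => 1)
  simp only [one_mul] at h2
  rw [h1, h2]
  simp only [if_true, Bool.false_eq_true, if_false]
  ring

/-- Combining two independent product-distributed points coordinatewise. -/
lemma cubeExp_comb (φ : Bool → Bool → Bool) (w₁ w₂ w₃ : Bool → ℝ)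
    (hw : ∀ c, w₃ c = ∑ a, ∑ b, if φ a b = c then w₁ a * w₂ b else 0) (g : Cube n → ℝ) :
    cubeExp w₁ (fun x => cubeExp w₂ (fun y => g (fun i => φ (x i) (y i)))) = cubeExp w₃ g := by
  have h3 : ∀ z : Cube n, ∏ i, w₃ (z i)
      = ∑ x : Cube n, ∑ y : Cube n,
        if (fun i => φ (x i) (y i)) = z then (∏ i, w₁ (x i)) * ∏ i, w₂ (y i) else 0 := by
    intro z
    simp_rw [hw]
    rw [Finset.prod_univ_sum, Fintype.piFinset_univ]
    refine sum_congr rfl fun x _ => ?_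
    rw [Finset.prod_univ_sum, Fintype.piFinset_univ]
    refine sum_congr rfl fun y _ => ?_
    rw [Finset.prod_ite_zero, prod_mul_distrib]
    simp [funext_iff]
  unfold cubeExp
  simp_rw [h3, sum_mul]
  rw [sum_comm]
  refine sum_congr rfl fun x _ => ?_
  rw [sum_comm, mul_sum]
  refine sum_congr rfl fun y _ => ?_
  simp [ite_mul, mul_assoc]

/-- The meet of two independent uniform points has independent coordinates, each `true` with
probability 1/4. -/
lemma sum_sum_inf (g : Cube n → ℝ) :
    ∑ x : Cube n, ∑ y : Cube n, g (x ⊓ y) = 4 ^ n * cubeExp (biasWeight (1 / 4)) g := by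
  have h := cubeExp_comb (n := n) (fun a b => a ⊓ b) (fun _ => 1 / 2) (fun _ => 1 / 2)
    (biasWeight (1 / 4)) (by intro c; cases c <;> simp [biasWeight] <;> norm_num) g
  rw [← h]
  simp only [cubeExp, prod_const, card_univ, Fintype.card_fin, ← mul_sum]
  rw [← mul_assoc, ← mul_assoc, ← mul_pow, ← mul_pow]
  norm_num
  rfl

/-- The join of k independent points of bias l has bias 1 - (1 - l)^k, and g of a join is at most
the product of the values of g. -/
lemma cubeExp_le_pow {g : Cube n → ℝ} (hg0 : ∀ x, 0 ≤ g x) (hg1 : ∀ x, g x ≤ 1)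
    (hsub : ∀ x y, g (x ⊔ y) ≤ g x * g y) {l : ℝ} (h0 : 0 ≤ l) (h1 : l ≤ 1) (k : ℕ) :
    cubeExp (biasWeight (1 - (1 - l) ^ k)) g ≤ cubeExp (biasWeight l) g ^ k := by
  induction k with
  | zero =>
    have := cubeExp_mono (n := n) (biasWeight_nonneg (l := 1 - (1 - l) ^ 0) (by simp) (by simp)) hg1
    simpa [cubeExp_one] using this
  | succ k ih =>
    have hk0 : (0 : ℝ) ≤ 1 - (1 - l) ^ k := by
      have := pow_le_one₀ (n := k) (sub_nonneg.2 h1) (by linarith : 1 - l ≤ 1)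
      linarith
    have hk1 : 1 - (1 - l) ^ k ≤ 1 := by
      have := pow_nonneg (sub_nonneg.2 h1) k
      linarith
    have h := cubeExp_comb (n := n) (fun a b => a ⊔ b) (biasWeight (1 - (1 - l) ^ k)) (biasWeight l)
      (biasWeight (1 - (1 - l) ^ (k + 1)))
      (by intro c; cases c <;> simp [biasWeight] <;> ring) g
    rw [← h, pow_succ]
    have hA : cubeExp (biasWeight (1 - (1 - l) ^ k)) (fun x => cubeExp (biasWeight l)
        (fun y => g (fun i => x i ⊔ y i))) ≤ cubeExp (biasWeight (1 - (1 - l) ^ k))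
          (fun x => g x * cubeExp (biasWeight l) g) := by
      refine cubeExp_mono (biasWeight_nonneg hk0 hk1) fun x => ?_
      rw [← cubeExp_const_mul]
      exact cubeExp_mono (biasWeight_nonneg h0 h1) fun y => hsub x y
    rw [cubeExp_mul_const] at hA
    exact hA.trans (mul_le_mul_of_nonneg_right ih (cubeExp_nonneg (biasWeight_nonneg h0 h1) hg0))

/-! ### Discrete derivatives -/

/-- The discrete derivative of `f` in the direction `i`. -/
def cubeDeriv (f : Cube n → ℝ) (i : Fin n) (x : Cube n) : ℝ :=
  f (Function.update x i true) - f (Function.update x i false)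

lemma cubeDeriv_update (f : Cube n → ℝ) (i : Fin n) (b : Bool) (x : Cube n) :
    cubeDeriv f i (Function.update x i b) = cubeDeriv f i x := by
  simp [cubeDeriv]

lemma cubeDeriv_flip (f : Cube n → ℝ) (i : Fin n) (x : Cube n) :
    cubeDeriv f i (flipCoord i x) = cubeDeriv f i x := cubeDeriv_update f i _ x

lemma CubeSubmodular.cubeDeriv_antitone {f : Cube n → ℝ} (hf : CubeSubmodular f) (i : Fin n) :
    Antitone (cubeDeriv f i) := by
  intro x y hxy
  have h := hf (Function.update x i true) (Function.update y i false)
  have h1 : Function.update x i true ⊔ Function.update y i false = Function.update y i true := by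
    funext j
    by_cases hj : j = i
    · subst hj; simp
    · simpa [hj, Bool.le_iff_imp] using hxy j
  have h2 : Function.update x i true ⊓ Function.update y i false = Function.update x i false := by
    funext j
    by_cases hj : j = i
    · subst hj; simp
    · simpa [hj, Bool.le_iff_imp] using hxy j
  rw [h1, h2] at h
  unfold cubeDeriv
  linarith

lemma cubeDeriv_abs_le_one {f : Cube n → ℝ} (h01 : ∀ x, f x ∈ Set.Icc (0 : ℝ) 1) (i : Fin n)
    (x : Cube n) : |cubeDeriv f i x| ≤ 1 := by
  have h1 := h01 (Function.update x i true)
  have h2 := h01 (Function.update x i false)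
  rw [abs_le]
  unfold cubeDeriv
  exact ⟨by linarith [h1.1, h2.2], by linarith [h1.2, h2.1]⟩

/-- The complementary function `x ↦ f (¬ x)`. -/
def cubeDual (f : Cube n → ℝ) (x : Cube n) : ℝ := f xᶜ

lemma CubeSubmodular.dual {f : Cube n → ℝ} (hf : CubeSubmodular f) :
    CubeSubmodular (cubeDual f) := by
  intro x y
  have := hf xᶜ yᶜ
  simp only [cubeDual, compl_sup, compl_inf]
  linarith

lemma compl_update (x : Cube n) (i : Fin n) (b : Bool) :
    (Function.update x i b)ᶜ = Function.update xᶜ i (!b) := by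
  funext j
  by_cases hj : j = i
  · subst hj; simp
  · simp [hj]

/-- Through this identity every bound on positive parts of derivatives also serves for negative
parts. -/
lemma cubeDeriv_dual (f : Cube n → ℝ) (i : Fin n) (x : Cube n) :
    cubeDeriv (cubeDual f) i x = -cubeDeriv f i xᶜ := by
  simp [cubeDeriv, cubeDual, compl_update]

lemma sum_compl (g : Cube n → ℝ) : ∑ x : Cube n, g xᶜ = ∑ x, g x :=
  Equiv.sum_comp (compl_involutive (α := Cube n)).toPerm g

/-- Telescoping: remove the elements of T one at a time; each drop of f is a derivative at a point
below x, hence at least the derivative at x. -/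
lemma CubeSubmodular.sum_cubeDeriv_le {f : Cube n → ℝ} (hf : CubeSubmodular f) (x : Cube n)
    (T : Finset (Fin n)) (hT : ∀ i ∈ T, x i = true) :
    ∑ i ∈ T, cubeDeriv f i x ≤ f x - f (fun j => x j && decide (j ∉ T)) := by
  induction T using Finset.induction_on with
  | empty => simp
  | insert i T hi ih =>
    rw [sum_insert hi]
    have h1 := ih fun j hj => hT j (mem_insert_of_mem hj)
    set y : Cube n := fun j => x j && decide (j ∉ T) with hy
    have hyx : y ≤ x := by
      intro j
      simp only [hy]
      cases x j <;> simp
    have h2 := hf.cubeDeriv_antitone i hyx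
    have h3 : Function.update y i true = y := by
      have : y i = true := by simp [hy, hi, hT i (mem_insert_self i T)]
      rw [← this, Function.update_eq_self]
    have h4 : Function.update y i false = fun j => x j && decide (j ∉ insert i T) := by
      funext j
      by_cases hj : j = i
      · subst hj; simp
      · simp [hy, hj]
    have h5 : cubeDeriv f i y = f y - f (fun j => x j && decide (j ∉ insert i T)) := by
      rw [cubeDeriv, h3, h4]
    linarith

lemma CubeSubmodular.sum_posPart_le {f : Cube n → ℝ} (hf : CubeSubmodular f)
    (h01 : ∀ x, f x ∈ Set.Icc (0 : ℝ) 1) (I : Finset (Fin n)) (x : Cube n) :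
    ∑ i ∈ I, (if x i then 1 else 0) * max (cubeDeriv f i x) 0 ≤ 1 := by
  have h := hf.sum_cubeDeriv_le x (I.filter fun i => x i = true ∧ 0 < cubeDeriv f i x)
    (fun i hi => (mem_filter.1 hi).2.1)
  rw [sum_filter] at h
  have h2 : ∑ i ∈ I, (if x i then 1 else 0) * max (cubeDeriv f i x) 0
      = ∑ i ∈ I, if x i = true ∧ 0 < cubeDeriv f i x then cubeDeriv f i x else 0 := by
    refine sum_congr rfl fun i _ => ?_
    by_cases hx : x i = true
    · by_cases hd : 0 < cubeDeriv f i x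
      · simp [hx, hd, hd.le]
      · simp [hx, hd, not_lt.1 hd]
    · simp [hx]
  rw [h2]
  linarith [(h01 x).2, (h01 (fun j => x j && decide (j ∉ I.filter fun i => x i = true ∧
    0 < cubeDeriv f i x))).1]

/-- Average the pointwise bound; the derivative in direction i ignores x_i, so the indicator of x_i
factors out as l. -/
lemma CubeSubmodular.cubeExp_sum_posPart_le {f : Cube n → ℝ} (hf : CubeSubmodular f)
    (h01 : ∀ x, f x ∈ Set.Icc (0 : ℝ) 1) (I : Finset (Fin n)) {l : ℝ} (h0 : 0 ≤ l) (h1 : l ≤ 1) :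
    l * ∑ i ∈ I, cubeExp (biasWeight l) (fun x => max (cubeDeriv f i x) 0) ≤ 1 := by
  have h := cubeExp_mono (biasWeight_nonneg h0 h1) (hf.sum_posPart_le h01 I)
  rw [cubeExp_one, cubeExp_sum] at h
  rw [mul_sum]
  refine le_trans (le_of_eq (sum_congr rfl fun i _ => ?_)) h
  rw [cubeExp_coord i (fun x => max (cubeDeriv f i x) 0)]
  intro x
  rw [cubeDeriv_flip]

/-- A second moment is reduced to a first moment at bias 1/4. One factor P x is raised to P (x ⊓ y);
in the other, each g i x acquires the indicator of x_i at the cost of a constant, after which the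
pointwise bound 1 applies. -/
lemma pow_mul_sum_sq_le {f : Cube n → ℝ} (hf : CubeSubmodular f)
    (h01 : ∀ x, f x ∈ Set.Icc (0 : ℝ) 1) (I : Finset (Fin n)) (g : Fin n → Cube n → ℝ)
    (hg0 : ∀ i x, 0 ≤ g i x) (hgD : ∀ i x, g i x ≤ max (cubeDeriv f i x) 0)
    (hanti : ∀ i, Antitone (g i)) (hflip : ∀ i x, g i (flipCoord i x) = g i x) :
    2 ^ n * ∑ x, (∑ i ∈ I, g i x) ^ 2 ≤ 4 * ∑ x : Cube n, ∑ y : Cube n, ∑ i ∈ I, g i (x ⊓ y) := by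
  set P : Cube n → ℝ := fun x => ∑ i ∈ I, g i x with hP
  have hPanti : Antitone P := fun x y h => sum_le_sum fun i _ => hanti i h
  have hP0 : ∀ x, 0 ≤ P x := fun x => sum_nonneg fun i _ => hg0 i x
  have hstep : ∀ i, ∑ x : Cube n, ∑ y : Cube n, P (x ⊓ y) * g i x
      ≤ 4 * ∑ x : Cube n, ∑ y : Cube n, (if x i then 1 else 0) * (P (x ⊓ y) * g i x) := by
    intro i
    -- Neither B nor g i sees coordinate i of x or y, so restricting to x_i = 1, y_i = 0 costs
    -- exactly a factor 4. On that event x ⊓ y is already `false` at i and B is P (x ⊓ y).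
    set B : Cube n → Cube n → ℝ := fun x y => P (Function.update (x ⊓ y) i false) with hB
    have e1 : ∀ x y : Cube n, Function.update (flipCoord i x ⊓ y) i false
        = Function.update (x ⊓ y) i false := by
      intro x y
      funext j
      by_cases hj : j = i
      · subst hj; simp
      · simp [hj, flipCoord_of_ne hj]
    have e2 : ∀ x y : Cube n, Function.update (x ⊓ flipCoord i y) i false
        = Function.update (x ⊓ y) i false := by
      intro x y
      rw [inf_comm, e1, inf_comm]
    have hle : ∀ x y, P (x ⊓ y) ≤ B x y := by
      intro x y
      apply hPanti
      intro j
      by_cases hj : j = i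
      · subst hj; simp
      · simp [hj]
    have hx : ∑ x : Cube n, (if x i then (1 : ℝ) else 0) * ∑ y : Cube n, B x y * g i x
        = 1 / 2 * ∑ x : Cube n, ∑ y : Cube n, B x y * g i x := by
      have := sum_coord_mul i (fun b => if b then (1 : ℝ) else 0)
        (fun x => ∑ y : Cube n, B x y * g i x) (fun x => by simp only [hB, e1, hflip])
      simpa using this
    have hy : ∀ x : Cube n, ∑ y : Cube n, (if y i then (0 : ℝ) else 1) * B x y
        = 1 / 2 * ∑ y : Cube n, B x y := by
      intro x
      have := sum_coord_mul i (fun b => if b then (0 : ℝ) else 1)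
        (fun y => B x y) (fun y => by simp only [hB, e2])
      simpa using this
    calc ∑ x : Cube n, ∑ y : Cube n, P (x ⊓ y) * g i x
        ≤ ∑ x : Cube n, ∑ y : Cube n, B x y * g i x :=
          sum_le_sum fun x _ => sum_le_sum fun y _ => mul_le_mul_of_nonneg_right (hle x y) (hg0 i x)
      _ = 4 * ∑ x : Cube n, ∑ y : Cube n,
            (if x i then 1 else 0) * ((if y i then (0 : ℝ) else 1) * B x y * g i x) := by
          simp_rw [← mul_sum, ← sum_mul, hy]
          simp_rw [← sum_mul] at hx
          have : ∑ x : Cube n, (if x i then (1 : ℝ) else 0) * ((1 / 2 * ∑ y : Cube n, B x y) * g i x)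
            = 1 / 2 * ∑ x : Cube n, (if x i then (1 : ℝ) else 0) * ((∑ y : Cube n, B x y) * g i x) := by
            rw [mul_sum]
            exact sum_congr rfl fun x _ => by ring
          rw [this, hx]
          ring
      _ ≤ _ := by
          refine mul_le_mul_of_nonneg_left (sum_le_sum fun x _ => sum_le_sum fun y _ => ?_)
            (by norm_num)
          refine mul_le_mul_of_nonneg_left ?_ (by split_ifs <;> norm_num)
          refine mul_le_mul_of_nonneg_right ?_ (hg0 i x)
          by_cases hyi : y i = true
          · simp [hyi, hP0]
          · have : Function.update (x ⊓ y) i false = x ⊓ y := by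
              have h0 : (x ⊓ y) i = false := by simp [Bool.eq_false_iff.2 hyi]
              conv_lhs => rw [← h0]
              exact Function.update_eq_self _ _
            simp [hyi, hB, this]
  calc 2 ^ n * ∑ x, (∑ i ∈ I, g i x) ^ 2
      = ∑ x : Cube n, ∑ _y : Cube n, P x * P x := by
        simp [mul_sum, hP, sq]
    _ ≤ ∑ x : Cube n, ∑ y : Cube n, P (x ⊓ y) * P x :=
        sum_le_sum fun x _ => sum_le_sum fun y _ =>
          mul_le_mul_of_nonneg_right (hPanti inf_le_left) (hP0 x)
    _ = ∑ i ∈ I, ∑ x : Cube n, ∑ y : Cube n, P (x ⊓ y) * g i x := by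
        rw [sum_comm (s := I)]
        refine sum_congr rfl fun x _ => ?_
        rw [sum_comm (s := I)]
        exact sum_congr rfl fun y _ => mul_sum ..
    _ ≤ ∑ i ∈ I, 4 * ∑ x : Cube n, ∑ y : Cube n, (if x i then 1 else 0) * (P (x ⊓ y) * g i x) :=
        sum_le_sum fun i _ => hstep i
    _ = 4 * ∑ x : Cube n, ∑ y : Cube n, P (x ⊓ y) * ∑ i ∈ I, (if x i then 1 else 0) * g i x := by
        rw [← mul_sum, sum_comm]
        congr 1
        refine sum_congr rfl fun x _ => ?_
        rw [sum_comm]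
        refine sum_congr rfl fun y _ => ?_
        rw [mul_sum]
        exact sum_congr rfl fun i _ => by ring
    _ ≤ _ := by
        refine mul_le_mul_of_nonneg_left (sum_le_sum fun x _ => sum_le_sum fun y _ => ?_)
          (by norm_num)
        refine mul_le_of_le_one_right (hP0 _) ?_
        refine le_trans (sum_le_sum fun i _ => ?_) (hf.sum_posPart_le h01 I x)
        exact mul_le_mul_of_nonneg_left (hgD i x) (by split_ifs <;> norm_num)

/-! ### Few coordinates with large derivatives -/

lemma CubeSubmodular.sum_sum_posPart_inf_le {f : Cube n → ℝ} (hf : CubeSubmodular f)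
    (h01 : ∀ x, f x ∈ Set.Icc (0 : ℝ) 1) (I : Finset (Fin n)) :
    ∑ x : Cube n, ∑ y : Cube n, ∑ i ∈ I, max (cubeDeriv f i (x ⊓ y)) 0 ≤ 4 * 4 ^ n := by
  rw [sum_sum_inf (fun x => ∑ i ∈ I, max (cubeDeriv f i x) 0), cubeExp_sum]
  have h := hf.cubeExp_sum_posPart_le h01 I (l := 1 / 4) (by norm_num) (by norm_num)
  have h4 : (0 : ℝ) < 4 ^ n := by positivity
  nlinarith

lemma two_pow_mul_two_pow_eq (n : ℕ) : (2 : ℝ) ^ n * 2 ^ n = 4 ^ n := by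
  rw [← mul_pow]; norm_num

lemma CubeSubmodular.posPart_antitone {f : Cube n → ℝ} (hf : CubeSubmodular f) (i : Fin n) :
    Antitone fun x => max (cubeDeriv f i x) 0 :=
  fun _ _ h => max_le_max (hf.cubeDeriv_antitone i h) le_rfl

lemma CubeSubmodular.sum_sq_sum_posPart_le {f : Cube n → ℝ} (hf : CubeSubmodular f)
    (h01 : ∀ x, f x ∈ Set.Icc (0 : ℝ) 1) (I : Finset (Fin n)) :
    ∑ x, (∑ i ∈ I, max (cubeDeriv f i x) 0) ^ 2 ≤ 16 * 2 ^ n := by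
  have h := pow_mul_sum_sq_le hf h01 I (fun i x => max (cubeDeriv f i x) 0)
    (fun _ _ => le_max_right _ _) (fun _ _ => le_rfl) hf.posPart_antitone
    (fun i x => by rw [cubeDeriv_flip])
  have h2 := hf.sum_sum_posPart_inf_le h01 I
  have h3 : (0 : ℝ) < 2 ^ n := by positivity
  rw [← two_pow_mul_two_pow_eq] at h2
  refine le_of_mul_le_mul_left ?_ h3
  linarith

/-- The probability, under the product measure of bias `l`, that the derivative in direction `i`
exceeds `a`. -/
noncomputable def largeDerivProb (f : Cube n → ℝ) (a : ℝ) (i : Fin n) (l : ℝ) : ℝ :=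
  cubeExp (biasWeight l) (fun x => if a < cubeDeriv f i x then 1 else 0)

/-- Markov's inequality for each positive part. -/
lemma CubeSubmodular.mul_sum_largeDerivProb_le {f : Cube n → ℝ} (hf : CubeSubmodular f)
    (h01 : ∀ x, f x ∈ Set.Icc (0 : ℝ) 1) (I : Finset (Fin n)) {a l : ℝ}
    (h0 : 0 ≤ l) (h1 : l ≤ 1) : l * a * ∑ i ∈ I, largeDerivProb f a i l ≤ 1 := by
  refine le_trans ?_ (hf.cubeExp_sum_posPart_le h01 I h0 h1)
  rw [mul_assoc, mul_sum]
  refine mul_le_mul_of_nonneg_left (sum_le_sum fun i _ => ?_) h0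
  rw [largeDerivProb, ← cubeExp_const_mul]
  refine cubeExp_mono (biasWeight_nonneg h0 h1) fun x => ?_
  split_ifs with h
  · simpa using Or.inl h.le
  · simp

lemma CubeSubmodular.largeDerivProb_le_pow {f : Cube n → ℝ} (hf : CubeSubmodular f) (a : ℝ)
    (i : Fin n) {l : ℝ} (h0 : 0 ≤ l) (h1 : l ≤ 1) (k : ℕ) :
    largeDerivProb f a i (1 - (1 - l) ^ k) ≤ largeDerivProb f a i l ^ k := by
  refine cubeExp_le_pow (fun x => by split_ifs <;> norm_num) (fun x => by split_ifs <;> norm_num)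
    (fun x y => ?_) h0 h1 k
  have hx := hf.cubeDeriv_antitone i (le_sup_left : x ≤ x ⊔ y)
  have hy := hf.cubeDeriv_antitone i (le_sup_right : y ≤ x ⊔ y)
  by_cases h : a < cubeDeriv f i (x ⊔ y)
  · simp [h, h.trans_le hx, h.trans_le hy]
  · simp only [h, if_false]
    split_ifs <;> norm_num

/-- The bias at which k joined copies reach 1/4; Bernoulli's inequality gives the lower bound. -/
lemma exists_bias_pow {k : ℕ} (hk : 0 < k) :
    ∃ l : ℝ, 1 / (4 * k) ≤ l ∧ l ≤ 1 ∧ 1 - (1 - l) ^ k = 1 / 4 := by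
  have hk' : (1 : ℝ) ≤ k := by exact_mod_cast hk
  refine ⟨1 - (3 / 4 : ℝ) ^ ((k : ℝ)⁻¹), ?_, ?_, ?_⟩
  · have hb : (0 : ℝ) ≤ 1 - 1 / (4 * k) := by
      rw [sub_nonneg, div_le_one (by positivity)]
      linarith
    have h := one_add_mul_le_pow (a := -(1 / (4 * k) : ℝ)) (by linarith) k
    have h2 : (1 : ℝ) + k * -(1 / (4 * k)) = 3 / 4 := by
      field_simp
      norm_num
    rw [h2, ← sub_eq_add_neg] at h
    have h3 := Real.rpow_le_rpow (by norm_num) h (by positivity : (0 : ℝ) ≤ (k : ℝ)⁻¹)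
    rw [Real.pow_rpow_inv_natCast hb hk.ne'] at h3
    linarith
  · have : (0 : ℝ) ≤ (3 / 4 : ℝ) ^ ((k : ℝ)⁻¹) := by positivity
    linarith
  · rw [sub_sub_cancel, Real.rpow_inv_natCast_pow (by norm_num) hk.ne']
    norm_num

/-- Outside a small set of coordinates the large derivatives contribute little. -/
lemma CubeSubmodular.exists_small_set {f : Cube n → ℝ} (hf : CubeSubmodular f)
    (h01 : ∀ x, f x ∈ Set.Icc (0 : ℝ) 1) {a : ℝ} (ha : 0 < a) {k : ℕ} (hk : 0 < k)
    (hka : 32 * k * (1 / 2) ^ k ≤ a ^ 2) :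
    ∃ J : Finset (Fin n), (J.card : ℝ) ≤ 8 * k / a ∧ ∀ I : Finset (Fin n), Disjoint I J →
      ∑ x, (∑ i ∈ I, if a < cubeDeriv f i x then cubeDeriv f i x else 0) ^ 2 ≤ a * 2 ^ n := by
  obtain ⟨l, hl, hl1, hlk⟩ := exists_bias_pow hk
  have hk' : (0 : ℝ) < k := by exact_mod_cast hk
  have hl0 : 0 < l := lt_of_lt_of_le (by positivity) hl
  have hp0 : ∀ i, 0 ≤ largeDerivProb f a i l := fun i =>
    cubeExp_nonneg (biasWeight_nonneg hl0.le hl1) fun x => by split_ifs <;> norm_num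
  have hsum : ∀ I : Finset (Fin n), ∑ i ∈ I, largeDerivProb f a i l ≤ 4 * k / a := by
    intro I
    have h := hf.mul_sum_largeDerivProb_le (a := a) h01 I hl0.le hl1
    have hS : 0 ≤ ∑ i ∈ I, largeDerivProb f a i l := sum_nonneg fun i _ => hp0 i
    rw [div_le_iff₀ (by positivity)] at hl
    rw [le_div_iff₀ ha]
    have h2 : 0 ≤ a * ∑ i ∈ I, largeDerivProb f a i l := by positivity
    nlinarith
  -- The probabilities sum to at most 4k/a, so at most 8k/a of them exceed 1/2.
  refine ⟨univ.filter fun i => 1 / 2 < largeDerivProb f a i l, ?_, fun I hI => ?_⟩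
  · have h1 := hsum (univ.filter fun i => 1 / 2 < largeDerivProb f a i l)
    have h2 := card_nsmul_le_sum (univ.filter fun i => 1 / 2 < largeDerivProb f a i l)
      (fun i => largeDerivProb f a i l) (1 / 2) fun i hi => (mem_filter.1 hi).2.le
    rw [nsmul_eq_mul] at h2
    have : 8 * k / a = 2 * (4 * k / a) := by ring
    linarith
  · set g : Fin n → Cube n → ℝ := fun i x => if a < cubeDeriv f i x then cubeDeriv f i x else 0
      with hg
    have hg0 : ∀ i x, 0 ≤ g i x := by
      intro i x
      simp only [hg]
      split_ifs with h
      · exact (ha.trans h).le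
      · exact le_rfl
    have hgD : ∀ i x, g i x ≤ max (cubeDeriv f i x) 0 := by
      intro i x
      simp only [hg]
      split_ifs
      · exact le_max_left _ _
      · exact le_max_right _ _
    have hanti : ∀ i, Antitone (g i) := by
      intro i x y hxy
      have h := hf.cubeDeriv_antitone i hxy
      by_cases hy : a < cubeDeriv f i y
      · simpa [hg, hy, hy.trans_le h] using h
      · simpa [hg, hy] using hg0 i x
    have hmain := pow_mul_sum_sq_le hf h01 I g hg0 hgD hanti
      fun i x => by simp only [hg, cubeDeriv_flip]
    rw [sum_sum_inf (fun x => ∑ i ∈ I, g i x), cubeExp_sum] at hmain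
    have hpow : ∀ i ∈ I, cubeExp (biasWeight (1 / 4)) (g i)
        ≤ 2 * (1 / 2) ^ k * largeDerivProb f a i l := by
      intro i hi
      have hle : largeDerivProb f a i l ≤ 1 / 2 := by
        by_contra hcon
        exact (disjoint_left.1 hI hi) (mem_filter.2 ⟨mem_univ i, not_le.1 hcon⟩)
      have h1 : cubeExp (biasWeight (1 / 4)) (g i) ≤ largeDerivProb f a i (1 / 4) := by
        refine cubeExp_mono (biasWeight_nonneg (by norm_num) (by norm_num)) fun x => ?_
        simp only [hg]
        split_ifs
        · exact (abs_le.1 (cubeDeriv_abs_le_one h01 i x)).2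
        · exact le_rfl
      have h2 := hf.largeDerivProb_le_pow a i hl0.le hl1 k
      rw [hlk] at h2
      -- One of the k factors is kept so that the sum over i stays bounded independently of n.
      obtain ⟨m, rfl⟩ : ∃ m, k = m + 1 := ⟨k - 1, by omega⟩
      have h3 := mul_le_mul_of_nonneg_right (pow_le_pow_left₀ (hp0 i) hle m) (hp0 i)
      rw [← pow_succ] at h3
      have h4 : (2 : ℝ) * (1 / 2) ^ (m + 1) = (1 / 2) ^ m := by ring
      rw [h4]
      linarith
    have h5 : ∑ i ∈ I, cubeExp (biasWeight (1 / 4)) (g i) ≤ 2 * (1 / 2) ^ k * (4 * k / a) :=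
      (sum_le_sum hpow).trans (by
        rw [← mul_sum]; exact mul_le_mul_of_nonneg_left (hsum I) (by positivity))
    have h6 : 4 * (2 * (1 / 2) ^ k * (4 * k / a)) ≤ a := by
      have : 4 * (2 * (1 / 2) ^ k * (4 * k / a)) = (32 * k * (1 / 2) ^ k) / a := by ring
      rw [this, div_le_iff₀ ha]
      linarith
    have h7 : (0 : ℝ) < 2 ^ n := by positivity
    have h8 : (0 : ℝ) < 4 ^ n := by positivity
    refine le_of_mul_le_mul_left ?_ h7
    calc _ ≤ _ := hmain
      _ ≤ 4 ^ n * a := by nlinarith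
      _ = _ := by rw [← two_pow_mul_two_pow_eq]; ring

/-! ### Second derivatives -/

/-- The negated mixed second derivative of `f` in the directions `i`, `j`. -/
def cubeHess (f : Cube n → ℝ) (i j : Fin n) (x : Cube n) : ℝ :=
  cubeDeriv f i (Function.update x j false) - cubeDeriv f i (Function.update x j true)

lemma cubeHess_self (f : Cube n → ℝ) (i : Fin n) (x : Cube n) : cubeHess f i i x = 0 := by
  simp [cubeHess, cubeDeriv_update]

lemma cubeHess_comm (f : Cube n → ℝ) (i j : Fin n) (x : Cube n) :
    cubeHess f i j x = cubeHess f j i x := by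
  by_cases h : i = j
  · rw [h]
  · simp only [cubeHess, cubeDeriv]
    rw [Function.update_comm h, Function.update_comm h, Function.update_comm h,
      Function.update_comm h]
    ring

lemma CubeSubmodular.cubeHess_nonneg {f : Cube n → ℝ} (hf : CubeSubmodular f) (i j : Fin n)
    (x : Cube n) : 0 ≤ cubeHess f i j x := by
  refine sub_nonneg.2 (hf.cubeDeriv_antitone i ?_)
  exact update_le_update_iff.2 ⟨by simp, fun _ _ => le_rfl⟩

/-- The odd extension of `t ↦ t ^ (3/2)`. -/
noncomputable def signedThreeHalves (t : ℝ) : ℝ := t * √|t|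

lemma signedThreeHalves_of_nonneg {t : ℝ} (h : 0 ≤ t) : signedThreeHalves t = t * √t := by
  rw [signedThreeHalves, abs_of_nonneg h]

lemma signedThreeHalves_neg (t : ℝ) : signedThreeHalves (-t) = -signedThreeHalves t := by
  simp [signedThreeHalves]

lemma half_mul_sqrt_half_ge {h m : ℝ} (h0 : 0 ≤ h) (hm : h / 2 ≤ m) :
    h * √h / 4 ≤ m * √m := by
  have h1 : √h / 2 ≤ √m := by
    rw [← Real.sqrt_sq (by norm_num : (0 : ℝ) ≤ 2), ← Real.sqrt_div h0]
    exact Real.sqrt_le_sqrt (by linarith)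
  have h2 := mul_le_mul hm h1 (by positivity) (by linarith)
  linarith

lemma sub_mul_sqrt_le_of_nonneg {a b : ℝ} (ha : 0 ≤ a) (hab : a ≤ b) :
    (b - a) * √(b - a) ≤ b * √b - a * √a := by
  have h1 : √(b - a) ≤ √b := Real.sqrt_le_sqrt (by linarith)
  have h2 : √a ≤ √b := Real.sqrt_le_sqrt hab
  have h3 := mul_le_mul_of_nonneg_left h1 (sub_nonneg.2 hab)
  have h4 := mul_le_mul_of_nonneg_left h2 ha
  linarith

/-- For equal signs this is superadditivity of t^(3/2). For opposite signs one of |a|, |b| is at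
least half of b - a, which costs the factor 4. -/
lemma signedThreeHalves_sub_ge {a b : ℝ} (hab : a ≤ b) :
    (b - a) * √(b - a) / 4 ≤ signedThreeHalves b - signedThreeHalves a := by
  have hp : 0 ≤ (b - a) * √(b - a) := mul_nonneg (sub_nonneg.2 hab) (Real.sqrt_nonneg _)
  rcases le_total 0 a with ha | ha
  · rw [signedThreeHalves_of_nonneg ha, signedThreeHalves_of_nonneg (ha.trans hab)]
    linarith [sub_mul_sqrt_le_of_nonneg ha hab]
  rw [← neg_neg a, signedThreeHalves_neg, signedThreeHalves_of_nonneg (neg_nonneg.2 ha)]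
  rcases le_total b 0 with hb | hb
  · rw [← neg_neg b, signedThreeHalves_neg, signedThreeHalves_of_nonneg (neg_nonneg.2 hb)]
    have h := sub_mul_sqrt_le_of_nonneg (neg_nonneg.2 hb) (neg_le_neg hab)
    have e : - -b - - -a = -a - -b := by ring
    rw [e]
    rw [show b - a = -a - -b by ring] at hp
    linarith
  · rw [signedThreeHalves_of_nonneg hb, neg_neg]
    have h1 : 0 ≤ b * √b := mul_nonneg hb (Real.sqrt_nonneg _)
    have h2 : 0 ≤ -a * √(-a) := mul_nonneg (neg_nonneg.2 ha) (Real.sqrt_nonneg _)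
    rcases le_total (-a) b with h | h
    · linarith [half_mul_sqrt_half_ge (sub_nonneg.2 hab) (by linarith : (b - a) / 2 ≤ b)]
    · linarith [half_mul_sqrt_half_ge (sub_nonneg.2 hab) (by linarith : (b - a) / 2 ≤ -a)]

/-- Exchange the `j`-th coordinates of two points. -/
def swapCoord (j : Fin n) (p : Cube n × Cube n) : Cube n × Cube n :=
  (Function.update p.1 j (p.2 j), Function.update p.2 j (p.1 j))

lemma swapCoord_involutive (j : Fin n) : Function.Involutive (swapCoord j) := by
  rintro ⟨x, y⟩
  simp [swapCoord]

lemma sum_swapCoord (j : Fin n) (g : Cube n × Cube n → ℝ) :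
    ∑ p, g (swapCoord j p) = ∑ p, g p :=
  Equiv.sum_comp (swapCoord_involutive j).toPerm g

lemma swapCoord_inf (j : Fin n) (p : Cube n × Cube n) :
    (swapCoord j p).1 ⊓ (swapCoord j p).2 = p.1 ⊓ p.2 := by
  funext i
  by_cases h : i = j
  · subst h; simp [swapCoord, Bool.and_comm]
  · simp [swapCoord, h]

lemma swapCoord_sup (j : Fin n) (p : Cube n × Cube n) :
    (swapCoord j p).1 ⊔ (swapCoord j p).2 = p.1 ⊔ p.2 := by
  funext i
  by_cases h : i = j
  · subst h; simp [swapCoord, Bool.or_comm]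
  · simp [swapCoord, h]

/-- The difference `x_j - y_j` of the `j`-th coordinates. -/
def coordDiff (j : Fin n) (p : Cube n × Cube n) : ℝ :=
  (if p.1 j then 1 else 0) - (if p.2 j then 1 else 0)

lemma coordDiff_swap_same (j : Fin n) (p : Cube n × Cube n) :
    coordDiff j (swapCoord j p) = -coordDiff j p := by
  simp [coordDiff, swapCoord]

lemma coordDiff_swap_of_ne {i j : Fin n} (h : i ≠ j) (p : Cube n × Cube n) :
    coordDiff i (swapCoord j p) = coordDiff i p := by
  simp [coordDiff, swapCoord, h]

/-- The square root of the drop of the derivative between the meet and the join. -/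
noncomputable def derivGap (f : Cube n → ℝ) (j : Fin n) (p : Cube n × Cube n) : ℝ :=
  √(cubeDeriv f j (p.1 ⊓ p.2) - cubeDeriv f j (p.1 ⊔ p.2))

lemma derivGap_swap (f : Cube n → ℝ) (i j : Fin n) (p : Cube n × Cube n) :
    derivGap f i (swapCoord j p) = derivGap f i p := by
  simp only [derivGap, swapCoord_inf, swapCoord_sup]

/-- A discrete divergence attached to the gaps of the derivatives. -/
noncomputable def gapDivergence (f : Cube n → ℝ) (I : Finset (Fin n)) (p : Cube n × Cube n) : ℝ :=
  ∑ j ∈ I, derivGap f j p * coordDiff j p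

/-- Swapping the j-th coordinates fixes meet and join, hence all gaps, and negates only `coordDiff
j`; distinct terms are therefore orthogonal. The diagonal is bounded by positive parts at the meet
for f and, after complementing, for its dual, each of mean at most 4. -/
lemma sum_gapDivergence_sq_le {f : Cube n → ℝ} (hf : CubeSubmodular f)
    (h01 : ∀ x, f x ∈ Set.Icc (0 : ℝ) 1) (I : Finset (Fin n)) :
    ∑ p, gapDivergence f I p ^ 2 ≤ 8 * 4 ^ n := by
  have hcross : ∀ j k, j ≠ k →
      ∑ p, (derivGap f j p * coordDiff j p) * (derivGap f k p * coordDiff k p) = 0 := by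
    intro j k hjk
    have h := sum_swapCoord j
      (fun p => (derivGap f j p * coordDiff j p) * (derivGap f k p * coordDiff k p))
    simp only [derivGap_swap, coordDiff_swap_same, coordDiff_swap_of_ne hjk.symm, mul_neg, neg_mul,
      sum_neg_distrib] at h
    linarith
  have hgap : ∀ j (p : Cube n × Cube n), derivGap f j p ^ 2
      ≤ max (cubeDeriv f j (p.1 ⊓ p.2)) 0 + max (cubeDeriv (cubeDual f) j (p.1ᶜ ⊓ p.2ᶜ)) 0 := by
    intro j p
    rw [derivGap, Real.sq_sqrt (sub_nonneg.2 (hf.cubeDeriv_antitone j inf_le_sup)),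
      cubeDeriv_dual, compl_inf, compl_compl, compl_compl, sub_eq_add_neg]
    exact add_le_add (le_max_left _ _) (le_max_left _ _)
  have hdual01 : ∀ x, cubeDual f x ∈ Set.Icc (0 : ℝ) 1 := fun x => h01 _
  calc ∑ p, gapDivergence f I p ^ 2
      = ∑ j ∈ I, ∑ k ∈ I,
          ∑ p, (derivGap f j p * coordDiff j p) * (derivGap f k p * coordDiff k p) := by
        simp_rw [gapDivergence, sq, sum_mul_sum]
        rw [sum_comm]
        exact sum_congr rfl fun j _ => sum_comm
    _ = ∑ j ∈ I, ∑ p, (derivGap f j p * coordDiff j p) * (derivGap f j p * coordDiff j p) :=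
        sum_congr rfl fun j hj => sum_eq_single_of_mem j hj fun k _ hk => hcross j k hk.symm
    _ ≤ ∑ j ∈ I, ∑ p : Cube n × Cube n, (max (cubeDeriv f j (p.1 ⊓ p.2)) 0
          + max (cubeDeriv (cubeDual f) j (p.1ᶜ ⊓ p.2ᶜ)) 0) := by
        refine sum_le_sum fun j _ => sum_le_sum fun p _ => le_trans ?_ (hgap j p)
        have : coordDiff j p ^ 2 ≤ 1 := by
          simp only [coordDiff]
          split_ifs <;> norm_num
        nlinarith [sq_nonneg (derivGap f j p)]
    _ = (∑ x : Cube n, ∑ y : Cube n, ∑ i ∈ I, max (cubeDeriv f i (x ⊓ y)) 0)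
        + ∑ x : Cube n, ∑ y : Cube n, ∑ i ∈ I, max (cubeDeriv (cubeDual f) i (x ⊓ y)) 0 := by
        rw [← sum_compl (fun x => ∑ y : Cube n, ∑ i ∈ I, max (cubeDeriv (cubeDual f) i (x ⊓ y)) 0)]
        rw [← sum_add_distrib, sum_comm, Fintype.sum_prod_type]
        refine sum_congr rfl fun x _ => ?_
        rw [← sum_compl (fun y => ∑ i ∈ I, max (cubeDeriv (cubeDual f) i (xᶜ ⊓ y)) 0),
          ← sum_add_distrib]
        exact sum_congr rfl fun y _ => sum_add_distrib
    _ ≤ 8 * 4 ^ n := by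
        linarith [hf.sum_sum_posPart_inf_le h01 I, hf.dual.sum_sum_posPart_inf_le hdual01 I]

/-- The sum of the derivatives raised to the signed power `3/2`. -/
noncomputable def derivPowSum (f : Cube n → ℝ) (I : Finset (Fin n)) (x : Cube n) : ℝ :=
  ∑ i ∈ I, signedThreeHalves (cubeDeriv f i x)

lemma derivPowSum_update_sub_ge {f : Cube n → ℝ} (hf : CubeSubmodular f) (I : Finset (Fin n))
    (j : Fin n) (x : Cube n) :
    ∑ i ∈ I, cubeHess f i j x * √(cubeHess f i j x) / 4
      ≤ derivPowSum f I (Function.update x j false) - derivPowSum f I (Function.update x j true) := by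
  rw [derivPowSum, derivPowSum, ← sum_sub_distrib]
  exact sum_le_sum fun i _ => signedThreeHalves_sub_ge (sub_nonneg.1 (hf.cubeHess_nonneg i j x))

/-- When the points differ at i, the segment through p.1 in direction i lies between the meet and
the join, and the derivative in direction j is antitone. -/
lemma sqrt_cubeHess_le_derivGap {f : Cube n → ℝ} (hf : CubeSubmodular f) (i j : Fin n)
    (p : Cube n × Cube n) (h : p.1 i ≠ p.2 i) : √(cubeHess f i j p.1) ≤ derivGap f j p := by
  rw [cubeHess_comm]
  refine Real.sqrt_le_sqrt (sub_le_sub (hf.cubeDeriv_antitone j ?_) (hf.cubeDeriv_antitone j ?_))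
  · intro k
    by_cases hk : k = i
    · subst hk
      rcases hx : p.1 k <;> rcases hy : p.2 k <;> simp_all
    · simp [hk, Bool.and_le_left]
  · intro k
    by_cases hk : k = i
    · subst hk
      rcases hx : p.1 k <;> rcases hy : p.2 k <;> simp_all
    · simp [hk, Bool.left_le_or]

/-- Summation by parts: symmetrizing under the swap of coordinate j turns the right side into the
gap times the drop of `derivPowSum` in direction j. The drop supplies the power 3/2 of each second
derivative, the gap the missing 1/2. -/
lemma sum_cubeHess_le_of_coord {f : Cube n → ℝ} (hf : CubeSubmodular f) (I : Finset (Fin n))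
    (j : Fin n) :
    ∑ p : Cube n × Cube n, ∑ i ∈ I, (if p.1 j ≠ p.2 j then 1 else 0) *
        ((if p.1 i ≠ p.2 i then 1 else 0) * (cubeHess f i j p.1 ^ 2 / 4))
      ≤ -2 * ∑ p : Cube n × Cube n, derivPowSum f I p.1 * (derivGap f j p * coordDiff j p) := by
  have hsw := sum_swapCoord j
    (fun p : Cube n × Cube n => derivPowSum f I p.1 * (derivGap f j p * coordDiff j p))
  simp only [derivGap_swap, coordDiff_swap_same] at hsw
  have hrw : -2 * ∑ p : Cube n × Cube n, derivPowSum f I p.1 * (derivGap f j p * coordDiff j p)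
      = ∑ p : Cube n × Cube n, derivGap f j p * (coordDiff j p *
        (derivPowSum f I (swapCoord j p).1 - derivPowSum f I p.1)) := by
    rw [show ∀ t : ℝ, -2 * t = -t - t from fun t => by ring]
    nth_rewrite 1 [← hsw]
    rw [← sum_neg_distrib, ← sum_sub_distrib]
    exact sum_congr rfl fun p _ => by ring
  rw [hrw]
  refine sum_le_sum fun p _ => ?_
  by_cases hp : p.1 j = p.2 j
  · simp [hp, coordDiff]
  have hself : ∀ b, p.1 j = b → Function.update p.1 j b = p.1 := by
    rintro b rfl
    exact Function.update_eq_self _ _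
  have hdiff : coordDiff j p * (derivPowSum f I (swapCoord j p).1 - derivPowSum f I p.1)
      = derivPowSum f I (Function.update p.1 j false)
        - derivPowSum f I (Function.update p.1 j true) := by
    rcases hx : p.1 j
    · have hy : p.2 j = true := by simpa [hx] using hp
      simp [coordDiff, swapCoord, hx, hy, hself false hx]
    · have hy : p.2 j = false := by simpa [hx] using hp
      simp [coordDiff, swapCoord, hx, hy, hself true hx]
  rw [hdiff]
  refine le_trans ?_ (mul_le_mul_of_nonneg_left (derivPowSum_update_sub_ge hf I j p.1)
    (Real.sqrt_nonneg _))
  rw [mul_sum]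
  refine sum_le_sum fun i _ => ?_
  have hh := hf.cubeHess_nonneg i j p.1
  have hq : 0 ≤ cubeHess f i j p.1 * √(cubeHess f i j p.1) / 4 := by positivity
  by_cases hi : p.1 i = p.2 i
  · have hg : 0 ≤ derivGap f j p := Real.sqrt_nonneg _
    simpa [hi] using mul_nonneg hg hq
  · have h1 := mul_le_mul_of_nonneg_right (sqrt_cubeHess_le_derivGap hf i j p hi) hq
    refine le_trans (le_of_eq ?_) h1
    have h2 := Real.mul_self_sqrt hh
    simp only [ne_eq, hp, hi, not_false_eq_true, if_true, one_mul]
    linear_combination (-(cubeHess f i j p.1) / 4) * h2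

lemma sum_two_coord_ne {i j : Fin n} (hij : i ≠ j) (x : Cube n) :
    ∑ y : Cube n, (if x j ≠ y j then (1 : ℝ) else 0) * (if x i ≠ y i then 1 else 0)
      = 2 ^ n / 4 := by
  rw [sum_coord_mul j (fun b => if x j ≠ b then (1 : ℝ) else 0)
    (fun y => if x i ≠ y i then 1 else 0) (fun y => by rw [flipCoord_of_ne hij])]
  have h := sum_coord_mul i (fun b => if x i ≠ b then (1 : ℝ) else 0) (fun _ : Cube n => 1)
    (fun _ => rfl)
  simp only [mul_one] at h
  rw [h]
  have hb : ∀ c : Bool, (if c ≠ true then (1 : ℝ) else 0) + (if c ≠ false then 1 else 0) = 1 := by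
    intro c; cases c <;> simp
  rw [hb, hb]
  simp
  ring

/-- The total squared second derivative is controlled by the `3/2` powers of the derivatives. -/
lemma sum_cubeHess_sq_le {f : Cube n → ℝ} (hf : CubeSubmodular f)
    (h01 : ∀ x, f x ∈ Set.Icc (0 : ℝ) 1) (I : Finset (Fin n)) {a : ℝ} (ha : 0 ≤ a)
    (hΨ : ∑ x, derivPowSum f I x ^ 2 ≤ 136 * a * 2 ^ n) :
    ∑ j ∈ I, ∑ i ∈ I, ∑ x, cubeHess f i j x ^ 2 ≤ 1056 * √a * 2 ^ n := by
  set H := ∑ j ∈ I, ∑ i ∈ I, ∑ x, cubeHess f i j x ^ 2 with hH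
  have hH0 : 0 ≤ H := by positivity
  have h2 : (0 : ℝ) < 2 ^ n := by positivity
  -- The 16 combines the 1/4 in the coordinatewise bound with the probability 1/4 that two points
  -- differ at both i and j.
  have hlow : 2 ^ n * H / 16 ≤ -2 * ∑ p : Cube n × Cube n,
      derivPowSum f I p.1 * gapDivergence f I p := by
    calc 2 ^ n * H / 16 = ∑ j ∈ I, ∑ i ∈ I, 2 ^ n / 16 * ∑ x, cubeHess f i j x ^ 2 := by
          simp_rw [← mul_sum]
          rw [← hH]
          ring
      _ = ∑ j ∈ I, ∑ p : Cube n × Cube n, ∑ i ∈ I, (if p.1 j ≠ p.2 j then 1 else 0) *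
          ((if p.1 i ≠ p.2 i then 1 else 0) * (cubeHess f i j p.1 ^ 2 / 4)) := by
          refine sum_congr rfl fun j _ => ?_
          rw [sum_comm]
          refine sum_congr rfl fun i _ => ?_
          rw [Fintype.sum_prod_type, mul_sum]
          refine sum_congr rfl fun x _ => ?_
          by_cases hij : i = j
          · simp [hij, cubeHess_self]
          · simp_rw [← mul_assoc]
            rw [← sum_mul, sum_two_coord_ne hij]
            ring
      _ ≤ ∑ j ∈ I, -2 * ∑ p : Cube n × Cube n,
            derivPowSum f I p.1 * (derivGap f j p * coordDiff j p) :=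
          sum_le_sum fun j _ => sum_cubeHess_le_of_coord hf I j
      _ = _ := by
          rw [← mul_sum, sum_comm]
          simp_rw [gapDivergence, mul_sum]
  have hcs := sum_mul_sq_le_sq_mul_sq univ (fun p : Cube n × Cube n => derivPowSum f I p.1)
    (gapDivergence f I)
  have hΨ2 : ∑ p : Cube n × Cube n, derivPowSum f I p.1 ^ 2 ≤ 2 ^ n * (136 * a * 2 ^ n) := by
    rw [Fintype.sum_prod_type]
    simpa [mul_sum] using mul_le_mul_of_nonneg_left hΨ h2.le
  have hM := sum_gapDivergence_sq_le hf h01 I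
  have hprod := hcs.trans (mul_le_mul hΨ2 hM (by positivity) (by positivity))
  -- Cauchy-Schwarz gives 4 · 136 · 8 = 4352 ≤ 66², and 1056 = 16 · 66.
  have hsq : (2 ^ n * H / 16) ^ 2 ≤ (66 * √a * 4 ^ n) ^ 2 := by
    have h1 := pow_le_pow_left₀ (by positivity) hlow 2
    have h3 := Real.sq_sqrt ha
    have e1 : 2 ^ n * (136 * a * 2 ^ n) * (8 * 4 ^ n) = 1088 * a * (4 ^ n * 4 ^ n) := by
      rw [← two_pow_mul_two_pow_eq]; ring
    have e2 : (66 * √a * 4 ^ n) ^ 2 = 4356 * a * (4 ^ n * 4 ^ n) := by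
      rw [mul_pow, mul_pow, h3]; ring
    rw [e1] at hprod
    rw [e2]
    have h5 : 0 ≤ a * (4 ^ n * 4 ^ n) := by positivity
    rw [mul_pow] at h1
    linarith
  have h4 := (sq_le_sq₀ (by positivity) (by positivity)).1 hsq
  rw [← two_pow_mul_two_pow_eq] at h4
  refine le_of_mul_le_mul_left ?_ h2
  linarith

/-- Split at |t| = a: below it √|t| ≤ √a, above it √|t| ≤ 1. -/
lemma abs_signedThreeHalves_le {t a : ℝ} (ha : 0 ≤ a) (ht : |t| ≤ 1) :
    |signedThreeHalves t| ≤ √a * (max t 0 + max (-t) 0)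
      + ((if a < t then t else 0) + (if a < -t then -t else 0)) := by
  have h1 : |signedThreeHalves t| = |t| * √|t| := by
    rw [signedThreeHalves, abs_mul, abs_of_nonneg (Real.sqrt_nonneg _)]
  have h2 : max t 0 + max (-t) 0 = |t| := by
    rcases le_total 0 t with h | h
    · rw [max_eq_left h, max_eq_right (by linarith), abs_of_nonneg h, add_zero]
    · rw [max_eq_right h, max_eq_left (by linarith), abs_of_nonpos h, zero_add]
  have h3 : 0 ≤ if a < t then t else 0 := by split_ifs <;> linarith
  have h4 : 0 ≤ if a < -t then -t else 0 := by split_ifs <;> linarith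
  rw [h1, h2]
  rcases le_or_gt |t| a with h | h
  · have := mul_le_mul_of_nonneg_left (Real.sqrt_le_sqrt h) (abs_nonneg t)
    linarith
  · have h5 : |t| * √|t| ≤ |t| :=
      mul_le_of_le_one_right (abs_nonneg t) (Real.sqrt_le_one.2 ht)
    have h6 : 0 ≤ √a * |t| := by positivity
    rcases lt_abs.1 h with h7 | h7
    · rw [if_pos h7]
      rw [abs_of_pos (ha.trans_lt h7)] at h5 h6 ⊢
      linarith
    · rw [if_pos h7]
      rw [abs_of_neg (by linarith : t < 0)] at h5 h6 ⊢
      linarith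

/-- After discarding few coordinates the `3/2` powers of the derivatives are small on average. -/
lemma CubeSubmodular.exists_small_set_derivPowSum {f : Cube n → ℝ} (hf : CubeSubmodular f)
    (h01 : ∀ x, f x ∈ Set.Icc (0 : ℝ) 1) {a : ℝ} (ha : 0 < a) {k : ℕ} (hk : 0 < k)
    (hka : 32 * k * (1 / 2) ^ k ≤ a ^ 2) :
    ∃ J : Finset (Fin n), (J.card : ℝ) ≤ 16 * k / a ∧
      ∑ x, derivPowSum f Jᶜ x ^ 2 ≤ 136 * a * 2 ^ n := by
  have hdual01 : ∀ x, cubeDual f x ∈ Set.Icc (0 : ℝ) 1 := fun x => h01 _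
  obtain ⟨J₁, hc₁, hJ₁⟩ := hf.exists_small_set h01 ha hk hka
  obtain ⟨J₂, hc₂, hJ₂⟩ := hf.dual.exists_small_set hdual01 ha hk hka
  refine ⟨J₁ ∪ J₂, ?_, ?_⟩
  · have h : ((J₁ ∪ J₂).card : ℝ) ≤ J₁.card + J₂.card := by exact_mod_cast card_union_le J₁ J₂
    have : 16 * k / a = 8 * k / a + 8 * k / a := by ring
    linarith
  set I := (J₁ ∪ J₂)ᶜ with hI
  have hd₁ : Disjoint I J₁ := disjoint_compl_left.mono_right subset_union_left
  have hd₂ : Disjoint I J₂ := disjoint_compl_left.mono_right subset_union_right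
  have b₁ := hf.sum_sq_sum_posPart_le h01 I
  have b₂ := hf.dual.sum_sq_sum_posPart_le hdual01 I
  have b₃ := hJ₁ I hd₁
  have b₄ := hJ₂ I hd₂
  rw [← sum_compl] at b₂ b₄
  simp only [cubeDeriv_dual, compl_compl] at b₂ b₄
  set P₁ : Cube n → ℝ := fun x => ∑ i ∈ I, max (cubeDeriv f i x) 0 with hP₁
  set P₂ : Cube n → ℝ := fun x => ∑ i ∈ I, max (-cubeDeriv f i x) 0 with hP₂
  set P₃ : Cube n → ℝ := fun x => ∑ i ∈ I, if a < cubeDeriv f i x then cubeDeriv f i x else 0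
    with hP₃
  set P₄ : Cube n → ℝ := fun x => ∑ i ∈ I, if a < -cubeDeriv f i x then -cubeDeriv f i x else 0
    with hP₄
  have hpt : ∀ x, derivPowSum f I x ^ 2
      ≤ 4 * a * P₁ x ^ 2 + 4 * a * P₂ x ^ 2 + 4 * P₃ x ^ 2 + 4 * P₄ x ^ 2 := by
    intro x
    have h : |derivPowSum f I x| ≤ √a * (P₁ x + P₂ x) + (P₃ x + P₄ x) := by
      simp only [hP₁, hP₂, hP₃, hP₄, ← sum_add_distrib, mul_sum]
      exact (abs_sum_le_sum_abs _ _).trans (sum_le_sum fun i _ =>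
        abs_signedThreeHalves_le ha.le (cubeDeriv_abs_le_one h01 i x))
    have h2 := pow_le_pow_left₀ (abs_nonneg _) h 2
    rw [sq_abs] at h2
    have h3 := Real.sq_sqrt ha.le
    have e1 : 4 * a * P₁ x ^ 2 = 4 * (√a * P₁ x) ^ 2 := by rw [mul_pow, h3]; ring
    have e2 : 4 * a * P₂ x ^ 2 = 4 * (√a * P₂ x) ^ 2 := by rw [mul_pow, h3]; ring
    rw [e1, e2]
    nlinarith [sq_nonneg (√a * P₁ x - √a * P₂ x), sq_nonneg (P₃ x - P₄ x),
      sq_nonneg (√a * P₁ x + √a * P₂ x - P₃ x - P₄ x)]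
  -- The four sums contribute 4 · 16 + 4 · 16 + 4 + 4 = 136 times a.
  refine (sum_le_sum fun x _ => hpt x).trans ?_
  simp_rw [sum_add_distrib, ← mul_sum]
  have h5 := mul_le_mul_of_nonneg_left b₁ ha.le
  have h6 := mul_le_mul_of_nonneg_left b₂ ha.le
  linarith

/-! ### Walsh expansion -/

/-- The Walsh function indexed by `s`. -/
def walsh (s x : Cube n) : ℝ := ∏ i, if s i && x i then -1 else 1

lemma walsh_comm (s x : Cube n) : walsh s x = walsh x s := by
  simp [walsh, and_comm]

lemma sum_walsh_mul_walsh (x y : Cube n) :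
    ∑ s : Cube n, walsh s x * walsh s y = if x = y then 2 ^ n else 0 := by
  simp_rw [walsh, ← prod_mul_distrib]
  rw [sum_prod_coord (fun i b => (if b && x i then (-1 : ℝ) else 1) * if b && y i then -1 else 1)]
  have h : ∀ i : Fin n, ((if true && x i then (-1 : ℝ) else 1) * (if true && y i then -1 else 1)
      + (if false && x i then (-1 : ℝ) else 1) * (if false && y i then -1 else 1))
      = if x i = y i then 2 else 0 := by
    intro i
    cases x i <;> cases y i <;> norm_num
  simp_rw [h]
  rw [prod_ite_zero]
  simp [funext_iff]

lemma sum_walsh_mul_walsh' (s t : Cube n) :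
    ∑ x : Cube n, walsh s x * walsh t x = if s = t then 2 ^ n else 0 := by
  simp_rw [walsh_comm s, walsh_comm t]
  exact sum_walsh_mul_walsh s t

/-- The Walsh coefficients of `f`. -/
noncomputable def walshCoeff (f : Cube n → ℝ) (s : Cube n) : ℝ := (∑ x, f x * walsh s x) / 2 ^ n

lemma sum_walshCoeff_mul_walsh (f : Cube n → ℝ) (x : Cube n) :
    ∑ s, walshCoeff f s * walsh s x = f x := by
  simp_rw [walshCoeff, div_mul_eq_mul_div, ← sum_div, sum_mul]
  rw [sum_comm]
  simp_rw [mul_assoc, ← mul_sum, sum_walsh_mul_walsh]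
  simp

lemma sum_sq_walsh_sum (S : Finset (Cube n)) (c : Cube n → ℝ) :
    ∑ x, (∑ s ∈ S, c s * walsh s x) ^ 2 = 2 ^ n * ∑ s ∈ S, c s ^ 2 := by
  simp_rw [sq, sum_mul_sum]
  rw [sum_comm, mul_sum]
  refine sum_congr rfl fun s hs => ?_
  rw [sum_comm]
  have : ∀ t ∈ S, ∑ x, c s * walsh s x * (c t * walsh t x)
      = if s = t then c s * c t * 2 ^ n else 0 := by
    intro t _
    have := sum_walsh_mul_walsh' s t
    calc _ = c s * c t * ∑ x, walsh s x * walsh t x := by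
          rw [mul_sum]; exact sum_congr rfl fun x _ => by ring
      _ = _ := by rw [this]; split_ifs <;> simp
  rw [sum_congr rfl this, sum_ite_eq, if_pos hs]
  ring

lemma sum_sq_eq_walshCoeff (f : Cube n → ℝ) :
    ∑ x, f x ^ 2 = 2 ^ n * ∑ s, walshCoeff f s ^ 2 := by
  rw [← sum_sq_walsh_sum]
  exact sum_congr rfl fun x _ => by rw [sum_walshCoeff_mul_walsh]

lemma walsh_flip (s x : Cube n) (i : Fin n) :
    walsh s (flipCoord i x) = (if s i then -1 else 1) * walsh s x := by
  rw [walsh, walsh, ← mul_prod_erase univ _ (mem_univ i), ← mul_prod_erase univ _ (mem_univ i),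
    ← mul_assoc, flipCoord_same]
  congr 1
  · cases s i <;> cases x i <;> norm_num
  · exact prod_congr rfl fun j hj => by rw [flipCoord_of_ne (ne_of_mem_erase hj)]

/-- The change of `f` when one coordinate is flipped. -/
def flipDiff (i : Fin n) (f : Cube n → ℝ) (x : Cube n) : ℝ := f x - f (flipCoord i x)

lemma walshCoeff_flipDiff (i : Fin n) (f : Cube n → ℝ) (s : Cube n) :
    walshCoeff (flipDiff i f) s = (if s i then 2 else 0) * walshCoeff f s := by
  have h := sum_flipCoord i (fun x => f (flipCoord i x) * walsh s x)
  simp only [flipCoord_involutive i _, walsh_flip] at h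
  have h2 : ∑ x, flipDiff i f x * walsh s x = (if s i then 2 else 0) * ∑ x, f x * walsh s x := by
    simp_rw [flipDiff, sub_mul, sum_sub_distrib]
    rw [← h]
    by_cases hs : s i = true
    · simp [hs, two_mul]
    · simp [hs]
  rw [walshCoeff, h2, walshCoeff, mul_div_assoc]

lemma cubeHess_sq_eq {i j : Fin n} (hij : i ≠ j) (f : Cube n → ℝ) (x : Cube n) :
    cubeHess f i j x ^ 2 = flipDiff i (flipDiff j f) x ^ 2 := by
  set F : Bool → Bool → ℝ := fun a b => f (Function.update (Function.update x i a) j b) with hF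
  have h1 : ∀ a b, f (Function.update (Function.update x j b) i a) = F a b := fun a b => by
    rw [Function.update_comm hij.symm]
  have h2 : f x = F (x i) (x j) := by simp [hF]
  have h3 : f (Function.update x j !x j) = F (x i) (!x j) := by simp [hF]
  have h4 : f (Function.update x i !x i) = F (!x i) (x j) := by
    rw [← h1]; simp
  have h5 : f (Function.update (Function.update x i !x i) j !x j) = F (!x i) (!x j) := rfl
  simp only [flipDiff, cubeHess, cubeDeriv, flipCoord, Function.update_of_ne hij.symm]
  rw [h1, h1, h1, h1, h2, h3, h4, h5]
  cases x i <;> cases x j <;> simp only [Bool.not_true, Bool.not_false] <;> ring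

lemma sum_cubeHess_sq_eq {i j : Fin n} (hij : i ≠ j) (f : Cube n → ℝ) :
    ∑ x, cubeHess f i j x ^ 2
      = 2 ^ n * ∑ s, 16 * walshCoeff f s ^ 2 * ((if s i then 1 else 0) * if s j then 1 else 0) := by
  simp_rw [cubeHess_sq_eq hij]
  rw [sum_sq_eq_walshCoeff]
  simp_rw [walshCoeff_flipDiff]
  congr 1
  refine sum_congr rfl fun s _ => ?_
  split_ifs <;> ring

/-- The number of coordinates of `I` in which `s` is `true`. -/
def countOn (I : Finset (Fin n)) (s : Cube n) : ℕ := (I.filter fun i => s i = true).card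

/-- By Parseval, each pair i ≠ j in s contributes the squared multiplier (2 · 2)² = 16; the diagonal
vanishes, so ordered pairs of distinct elements are counted. -/
lemma sum_sum_cubeHess_sq_eq (f : Cube n → ℝ) (I : Finset (Fin n)) :
    ∑ j ∈ I, ∑ i ∈ I, ∑ x, cubeHess f i j x ^ 2
      = 2 ^ n * ∑ s, 16 * walshCoeff f s ^ 2 * ((countOn I s : ℝ) ^ 2 - countOn I s) := by
  have hcount : ∀ s : Cube n, ∑ i ∈ I, (if s i then (1 : ℝ) else 0) = countOn I s := by
    intro s
    rw [countOn, sum_boole]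
  have h : ∀ s : Cube n, (countOn I s : ℝ) ^ 2 - countOn I s
      = ∑ j ∈ I, ∑ i ∈ I, if i = j then 0 else
        ((if s i then (1 : ℝ) else 0) * if s j then 1 else 0) := by
    intro s
    rw [← hcount, sq, sum_mul_sum, ← sum_sub_distrib]
    refine sum_congr rfl fun j hj => ?_
    have h1 : (if s j then (1 : ℝ) else 0) = ∑ i ∈ I, if i = j then (if s j then 1 else 0) else 0 := by
      rw [sum_ite_eq', if_pos hj]
    nth_rewrite 2 [h1]
    rw [← sum_sub_distrib]
    refine sum_congr rfl fun i _ => ?_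
    by_cases hij : i = j
    · subst hij; split_ifs <;> norm_num
    · rw [if_neg hij, if_neg hij, sub_zero, mul_comm]
  have hswap : ∑ s : Cube n, 16 * walshCoeff f s ^ 2 * ((countOn I s : ℝ) ^ 2 - countOn I s)
      = ∑ j ∈ I, ∑ i ∈ I, ∑ s : Cube n, 16 * walshCoeff f s ^ 2 * (if i = j then 0 else
        ((if s i then (1 : ℝ) else 0) * if s j then 1 else 0)) := by
    simp_rw [h, mul_sum (s := I)]
    rw [sum_comm]
    exact sum_congr rfl fun j _ => sum_comm
  rw [hswap, mul_sum]
  refine sum_congr rfl fun j _ => ?_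
  rw [mul_sum]
  refine sum_congr rfl fun i _ => ?_
  by_cases hij : i = j
  · simp [hij, cubeHess_self]
  · simp only [hij, if_false]
    rw [sum_cubeHess_sq_eq hij]

/-- The polynomial agreeing with a Walsh function on the cube. -/
noncomputable def walshPoly (s : Cube n) : MvPolynomial (Fin n) ℝ :=
  ∏ i ∈ univ.filter fun i => s i = true, (1 - MvPolynomial.C 2 * MvPolynomial.X i)

lemma polyOnCube_walshPoly (s x : Cube n) : polyOnCube (walshPoly s) x = walsh s x := by
  rw [polyOnCube, walshPoly, map_prod, prod_filter, walsh]
  refine prod_congr rfl fun i _ => ?_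
  cases s i <;> cases hx : x i <;> (simp [hx]; try norm_num)

lemma totalDegree_walshPoly_le (s : Cube n) :
    (walshPoly s).totalDegree ≤ (univ.filter fun i => s i = true).card := by
  refine (MvPolynomial.totalDegree_finsetProd _ _).trans ?_
  rw [card_eq_sum_ones]
  refine sum_le_sum fun i _ => ?_
  refine (MvPolynomial.totalDegree_sub _ _).trans ?_
  refine max_le (by simp) ((MvPolynomial.totalDegree_mul _ _).trans ?_)
  simp

lemma card_filter_le_card_add_countOn (J : Finset (Fin n)) (s : Cube n) :
    (univ.filter fun i => s i = true).card ≤ J.card + countOn Jᶜ s := by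
  rw [countOn]
  refine (card_le_card ?_).trans (card_union_le _ _)
  intro i hi
  by_cases h : i ∈ J <;> simp_all

/-- Approximation by a polynomial of low degree outside `J`. -/
lemma exists_poly_of_sum_cubeHess_sq_le (f : Cube n → ℝ) (J : Finset (Fin n)) {d : ℕ} (hd : 0 < d)
    {A : ℝ} (hA : ∑ j ∈ Jᶜ, ∑ i ∈ Jᶜ, ∑ x, cubeHess f i j x ^ 2 ≤ A * 2 ^ n) :
    ∃ p : MvPolynomial (Fin n) ℝ, p.totalDegree ≤ J.card + d ∧
      cubeL2Norm (fun x => f x - polyOnCube p x) ≤ √(A / (16 * d ^ 2)) := by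
  -- Only coordinates outside J are counted: dependence on J is kept in full and costs at most |J|
  -- in the degree.
  set S : Finset (Cube n) := univ.filter fun s => countOn Jᶜ s ≤ d with hS
  refine ⟨∑ s ∈ S, MvPolynomial.C (walshCoeff f s) * walshPoly s, ?_, ?_⟩
  · refine MvPolynomial.totalDegree_finsetSum_le fun s hs => ?_
    refine (MvPolynomial.totalDegree_mul _ _).trans ?_
    rw [MvPolynomial.totalDegree_C, zero_add]
    have h1 := totalDegree_walshPoly_le s
    have h2 := card_filter_le_card_add_countOn J s
    have h3 := (mem_filter.1 hs).2
    omega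
  · refine Real.sqrt_le_sqrt ?_
    have hdiff : ∀ x, f x - polyOnCube (∑ s ∈ S, MvPolynomial.C (walshCoeff f s) * walshPoly s) x
        = ∑ s ∈ Sᶜ, walshCoeff f s * walsh s x := by
      intro x
      have h1 : polyOnCube (∑ s ∈ S, MvPolynomial.C (walshCoeff f s) * walshPoly s) x
          = ∑ s ∈ S, walshCoeff f s * walsh s x := by
        simp_rw [← polyOnCube_walshPoly]
        simp [polyOnCube]
      rw [h1, ← sum_walshCoeff_mul_walsh f x, ← sum_add_sum_compl S, add_sub_cancel_left]
    simp_rw [hdiff]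
    rw [sum_sq_walsh_sum, mul_div_cancel_left₀ _ (by positivity)]
    rw [sum_sum_cubeHess_sq_eq, mul_comm A] at hA
    have hA' := le_of_mul_le_mul_left hA (by positivity)
    rw [le_div_iff₀ (by positivity)]
    refine le_trans ?_ hA'
    rw [sum_mul]
    have hnn : ∀ s : Cube n, 0 ≤ 16 * walshCoeff f s ^ 2 *
        ((countOn Jᶜ s : ℝ) ^ 2 - countOn Jᶜ s) := by
      intro s
      refine mul_nonneg (by positivity) (sub_nonneg.2 ?_)
      exact_mod_cast Nat.le_self_pow two_ne_zero _
    refine (sum_le_sum fun s hs => ?_).trans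
      (sum_le_sum_of_subset_of_nonneg (subset_univ Sᶜ) fun s _ _ => hnn s)
    have hs' : d + 1 ≤ countOn Jᶜ s := by
      simpa [hS] using hs
    have hs2 : (d : ℝ) + 1 ≤ countOn Jᶜ s := by exact_mod_cast hs'
    have h3 : (d : ℝ) ^ 2 ≤ (countOn Jᶜ s : ℝ) ^ 2 - countOn Jᶜ s := by nlinarith
    calc walshCoeff f s ^ 2 * (16 * d ^ 2) = 16 * walshCoeff f s ^ 2 * d ^ 2 := by ring
      _ ≤ _ := mul_le_mul_of_nonneg_left h3 (by positivity)

/-! ### Choice of parameters -/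

lemma exists_exponent {ε : ℝ} (h0 : 0 < ε) (h1 : ε ≤ 1 / 2) :
    ∃ k : ℕ, 0 < k ∧ (k : ℝ) ≤ 30 * Real.log (1 / ε) ∧
      32 * k * (1 / 2) ^ k ≤ (ε ^ (4 / 5 : ℝ)) ^ 2 := by
  set L := Real.log (1 / ε) with hL
  have hl2 := Real.log_two_gt_d9
  have hL2 : Real.log 2 ≤ L := by
    refine Real.log_le_log (by norm_num) ?_
    rw [le_div_iff₀ h0]
    linarith
  -- Since 12 log 2 > 8, this forces 2^m ≥ ε^(-8). With k = 2m, one factor 2^m absorbs m and the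
  -- other absorbs 64/ε².
  set m := ⌈12 * L⌉₊ with hm
  have hm1 : 12 * L ≤ m := Nat.le_ceil _
  have hm2 : (m : ℝ) < 12 * L + 1 := Nat.ceil_lt_add_one (by linarith)
  have hm0 : 0 < m := by
    have : (0 : ℝ) < m := by linarith
    exact_mod_cast this
  refine ⟨2 * m, by omega, ?_, ?_⟩
  · push_cast
    linarith
  have hmm : (m : ℝ) ≤ 2 ^ m := by exact_mod_cast Nat.lt_two_pow_self.le
  have hpow : (1 / ε) ^ 8 ≤ (2 : ℝ) ^ m := by
    have hpos : (0 : ℝ) < (1 / ε) ^ 8 := by positivity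
    rw [← Real.log_le_log_iff hpos (by positivity), Real.log_pow, Real.log_pow, ← hL]
    have : 12 * L * 0.69 ≤ m * Real.log 2 :=
      mul_le_mul hm1 (by linarith) (by norm_num) (by positivity)
    push_cast
    linarith
  have h64 : (64 : ℝ) ≤ (1 / ε) ^ 6 := by
    have : (2 : ℝ) ≤ 1 / ε := by rw [le_div_iff₀ h0]; linarith
    calc (64 : ℝ) = 2 ^ 6 := by norm_num
      _ ≤ _ := pow_le_pow_left₀ (by norm_num) this 6
  have hε2 : ε ^ 2 ≤ (ε ^ (4 / 5 : ℝ)) ^ 2 := by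
    refine pow_le_pow_left₀ h0.le ?_ 2
    nth_rewrite 1 [← Real.rpow_one ε]
    exact Real.rpow_le_rpow_of_exponent_ge h0 (by linarith) (by norm_num)
  refine le_trans ?_ hε2
  have hM : (0 : ℝ) < 2 ^ m := by positivity
  have e1 : 32 * ((2 * m : ℕ) : ℝ) * (1 / 2) ^ (2 * m) = 64 * m / (2 ^ m * 2 ^ m) := by
    rw [← pow_add, ← two_mul, one_div, inv_pow]
    push_cast
    ring
  rw [e1, div_le_iff₀ (by positivity)]
  have h2 : 64 * (1 / ε) ^ 2 ≤ 2 ^ m := by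
    refine le_trans ?_ hpow
    calc 64 * (1 / ε) ^ 2 ≤ (1 / ε) ^ 6 * (1 / ε) ^ 2 :=
          mul_le_mul_of_nonneg_right h64 (by positivity)
      _ = _ := by ring
  have h3 : 64 ≤ ε ^ 2 * 2 ^ m := by
    calc (64 : ℝ) = ε ^ 2 * (64 * (1 / ε) ^ 2) := by field_simp
      _ ≤ _ := mul_le_mul_of_nonneg_left h2 (by positivity)
  calc 64 * (m : ℝ) ≤ (ε ^ 2 * 2 ^ m) * 2 ^ m := mul_le_mul h3 hmm (by positivity) (by positivity)
    _ = _ := by ring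

lemma exists_poly_of_le_half {f : Cube n → ℝ} (hf : CubeSubmodular f)
    (h01 : ∀ x, f x ∈ Set.Icc (0 : ℝ) 1) {ε : ℝ} (h0 : 0 < ε) (h1 : ε ≤ 1 / 2) :
    ∃ p : MvPolynomial (Fin n) ℝ,
      (p.totalDegree : ℝ) ≤ 500 * ε ^ (-(4 / 5) : ℝ) * Real.log (1 / ε) ∧
      cubeL2Norm (fun x => f x - polyOnCube p x) ≤ ε := by
  obtain ⟨k, hk, hkL, hka⟩ := exists_exponent h0 h1
  set a := ε ^ (4 / 5 : ℝ) with ha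
  have ha0 : 0 < a := by positivity
  have hinv : ε ^ (-(4 / 5) : ℝ) = a⁻¹ := Real.rpow_neg h0.le _
  have ha1 : 1 ≤ a⁻¹ := (one_le_inv₀ ha0).2 (Real.rpow_le_one h0.le (by linarith) (by norm_num))
  obtain ⟨J, hJ, hΨ⟩ := hf.exists_small_set_derivPowSum h01 ha0 hk hka
  have hA := sum_cubeHess_sq_le hf h01 Jᶜ ha0.le hΨ
  -- The 9 is chosen so that 1056 ≤ 16 · 9². In the degree, |J| costs 16 · 30 = 480, and d ≤ 10/a
  -- costs 20 because log(1/ε) ≥ 1/2.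
  set d := ⌈9 * a⁻¹⌉₊ with hd
  have hd1 : 9 * a⁻¹ ≤ d := Nat.le_ceil _
  have hd2 : (d : ℝ) < 9 * a⁻¹ + 1 := Nat.ceil_lt_add_one (by positivity)
  have hd0 : 0 < d := by
    have : (0 : ℝ) < d := by linarith
    exact_mod_cast this
  obtain ⟨p, hp, hpe⟩ := exists_poly_of_sum_cubeHess_sq_le f J hd0 hA
  refine ⟨p, ?_, hpe.trans ?_⟩
  · have hp' : (p.totalDegree : ℝ) ≤ J.card + d := by exact_mod_cast hp
    have hL2 : 1 / 2 ≤ Real.log (1 / ε) := by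
      have hl2 := Real.log_two_gt_d9
      have : Real.log 2 ≤ Real.log (1 / ε) := by
        refine Real.log_le_log (by norm_num) ?_
        rw [le_div_iff₀ h0]
        linarith
      linarith
    have h3 : 16 * k / a ≤ 480 * a⁻¹ * Real.log (1 / ε) := by
      rw [div_eq_mul_inv]
      have := mul_le_mul_of_nonneg_right hkL (by positivity : 0 ≤ 16 * a⁻¹)
      linarith
    have h4 : 10 * a⁻¹ ≤ 20 * a⁻¹ * Real.log (1 / ε) := by
      have := mul_le_mul_of_nonneg_left hL2 (by positivity : 0 ≤ 20 * a⁻¹)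
      linarith
    rw [hinv]
    linarith
  · rw [Real.sqrt_le_left h0.le, div_le_iff₀ (by positivity)]
    have hsqrt : √a * a ^ 2 = ε ^ 2 := by
      rw [Real.sqrt_eq_rpow, ha, ← Real.rpow_mul h0.le, ← Real.rpow_natCast, ← Real.rpow_mul h0.le,
        ← Real.rpow_add h0, ← Real.rpow_natCast]
      norm_num
    have h5 : 81 ≤ a ^ 2 * d ^ 2 := by
      have h6 : 9 ≤ a * d := by
        have := mul_le_mul_of_nonneg_left hd1 ha0.le
        have e : a * (9 * a⁻¹) = 9 := by field_simp
        linarith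
      nlinarith
    calc 1056 * √a ≤ 16 * √a * (a ^ 2 * d ^ 2) := by nlinarith [Real.sqrt_nonneg a]
      _ = ε ^ 2 * (16 * d ^ 2) := by rw [← hsqrt]; ring

lemma cubeL2Norm_sub_half_le {f : Cube n → ℝ} (h01 : ∀ x, f x ∈ Set.Icc (0 : ℝ) 1) :
    cubeL2Norm (fun x => f x - polyOnCube (MvPolynomial.C (1 / 2)) x) ≤ 1 / 2 := by
  rw [cubeL2Norm, Real.sqrt_le_left (by norm_num), div_le_iff₀ (by positivity)]
  have h : ∀ x ∈ (univ : Finset (Cube n)),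
      (f x - polyOnCube (MvPolynomial.C (1 / 2)) x) ^ 2 ≤ (1 / 2) ^ 2 := by
    intro x _
    have h1 := (h01 x).1
    have h2 := (h01 x).2
    rw [polyOnCube, MvPolynomial.eval_C]
    nlinarith
  refine (sum_le_card_nsmul _ _ _ h).trans ?_
  simp
  linarith

end

theorem mainTheorem1 :
    ∃ C : ℝ, 0 < C ∧
      ∀ (n : ℕ) (f : Cube n → ℝ), CubeSubmodular f → (∀ x, f x ∈ Set.Icc (0 : ℝ) 1) →
        ∀ ε : ℝ, 0 < ε → ε ≤ 1 →
          ∃ p : MvPolynomial (Fin n) ℝ,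
            (p.totalDegree : ℝ) ≤ C * ε ^ (-(4 / 5) : ℝ) * Real.log (1 / ε) ∧
            cubeL2Norm (fun x => f x - polyOnCube p x) ≤ ε := by
  refine ⟨500, by norm_num, fun n f hf h01 ε h0 h1 => ?_⟩
  rcases le_or_gt ε (1 / 2) with h | h
  · exact exists_poly_of_le_half hf h01 h0 h
  -- As ε tends to 1 the degree bound tends to 0, so a constant is needed; 1/2 is within 1/2 of
  -- every value of f.
  · refine ⟨MvPolynomial.C (1 / 2), ?_, (cubeL2Norm_sub_half_le h01).trans h.le⟩
    rw [MvPolynomial.totalDegree_C]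
    have : 0 ≤ Real.log (1 / ε) := Real.log_nonneg ((one_le_div h0).2 h1)
    push_cast
    positivity
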